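/- **Definition.** Let $K$ be a field and $G$ a finite group. For a faithful finite-dimensional representation $\rho: G\to GL(V)$ over $K$, let $G$ act by $K$-automorphisms on the field $K(V)$ of rational functions on $V$, by $(g\cdot f)(v)=f(\rho(g)^{-1}v)$. A faithful $G$-subfield of $K(V)$ is a field $E$ with $K\subseteq E\subseteq K(V)$ that is stable under $G$ and on which only the identity of $G$ acts trivially. The essential dimension $\operatorname{ed}_K(G)$ is the minimum of the transcendence degrees $\operatorname{trdeg}_K E$ over all faithful $G$-subfields $E$ of $K(V)$; this number is known not to depend on the choice of $\rho$. **Theorem 1.6.** Let $K$ be an arbitrary field with $\operatorname{char} K=2$, let $q=2^r$ with $r\ge 1$, and let $G=SL_2(\mathbb F_q)$, where $\mathbb F_q$ is a field with $q$ elements. Then $\operatorname{ed}_K(G)=1$, computed with any faithful finite-dimensional representation of $G$ over $K$, if and only if $K$ contains a subfield isomorphic to $\mathbb F_q$. -/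

import Mathlib

noncomputable section

namespace EssDim

variable {K : Type*} [Field K] {G : Type*} [Group G]
  {V : Type*} [AddCommGroup V] [Module K V]

/-- The algebra `K[V]` of polynomial functions on `V`: the symmetric algebra of the dual `V*`. -/
abbrev PolyRing (K V : Type*) [Field K] [AddCommGroup V] [Module K V] : Type _ :=
  SymmetricAlgebra K (Module.Dual K V)

/-- The field `K(V)` of rational functions on `V`: the fraction field of `K[V]`. -/
abbrev FunField (K V : Type*) [Field K] [AddCommGroup V] [Module K V] : Type _ :=
  FractionRing (PolyRing K V)

/-- The action of `G` on `K[V]` attached to a representation `ρ` of `G` on `V`, by `K`-algebra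
endomorphisms. It extends the dual representation `(g • f) v = f (ρ g⁻¹ v)` on `V*`. -/
def polyActionHom (ρ : Representation K G V) : G →* (PolyRing K V →ₐ[K] PolyRing K V) where
  toFun g := SymmetricAlgebra.lift (SymmetricAlgebra.ι K (Module.Dual K V) ∘ₗ ρ.dual g)
  map_one' := by
    apply SymmetricAlgebra.algHom_ext
    rw [map_one, Module.End.one_eq_id, LinearMap.comp_id, SymmetricAlgebra.lift_ι]
    rfl
  map_mul' g h := by
    apply SymmetricAlgebra.algHom_ext
    refine LinearMap.ext fun f => ?_
    change SymmetricAlgebra.lift _ (SymmetricAlgebra.ι K _ f) =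
      SymmetricAlgebra.lift _ (SymmetricAlgebra.lift _ (SymmetricAlgebra.ι K _ f))
    rw [SymmetricAlgebra.lift_ι_apply, SymmetricAlgebra.lift_ι_apply, LinearMap.comp_apply,
      LinearMap.comp_apply, SymmetricAlgebra.lift_ι_apply, LinearMap.comp_apply, map_mul,
      Module.End.mul_apply]

/-- The same action of `G` on `K[V]`, by `K`-algebra automorphisms. -/
def polyAction (ρ : Representation K G V) : G →* (PolyRing K V ≃ₐ[K] PolyRing K V) :=
  (AlgEquiv.algHomUnitsEquiv K (PolyRing K V)).toMonoidHom.comp (polyActionHom ρ).toHomUnits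

/-- The action of `G` on the field `K(V)` by `K`-automorphisms that extends the action
on `K[V]`. -/
def fieldAction (ρ : Representation K G V) : G →* (FunField K V ≃ₐ[K] FunField K V) :=
  (IsFractionRing.fieldEquivOfAlgEquivHom K (FunField K V)).comp (polyAction ρ)

/-- Let `G` act on a field `L` by `K`-automorphisms, through `φ`. A subfield `E` of `L`
containing `K` is a faithful `G`-subfield if it is stable under `G` and only the identity of `G`
acts trivially on `E`. -/
structure IsFaithfulGSubfield {L : Type*} [Field L] [Algebra K L] (φ : G →* (L ≃ₐ[K] L))
    (E : IntermediateField K L) : Prop where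
  stable : ∀ g : G, ∀ x ∈ E, φ g x ∈ E
  faithful : ∀ g : G, (∀ x ∈ E, φ g x = x) → g = 1

/-- The essential dimension over `K` of a finite group `G`, computed from a (faithful,
finite-dimensional) representation `ρ` of `G` on `V`: the smallest transcendence degree
over `K` of a faithful `G`-subfield of `K(V)`. -/
def essDim (ρ : Representation K G V) : ℕ :=
  sInf {n : ℕ | ∃ E : IntermediateField K (FunField K V),
    IsFaithfulGSubfield (fieldAction ρ) E ∧ Algebra.trdeg K E = n}

end EssDim

end

/-! Suppose `F` embeds in `K`. In characteristic 2 a scalar matrix of determinant 1 is the identity,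
so `SL₂(F)` acts faithfully on the projective line over `K`. Averaging produces a nonzero pair `(x,
y)` in `K(V)` that transforms linearly under the group, and `K(x/y)` is a faithful subfield of
degree one (`exists_faithful_subfield_trdeg_one`). Degree zero is impossible: elements of `K(V)`
algebraic over `K` are constants, hence fixed.

Conversely, let `E` be a faithful subfield of degree one. The upper unipotents act on `V*` by
commuting operators `D` with `(D - 1)² = 0`, so `V*` has a basis with weights that every `D - 1`
strictly raises and the torus does not lower. Scaling the basis by powers of `s` given by the
weights expands `K(V)` into Laurent series; the order is invariant under torus and unipotents, and
unipotents fix leading coefficients (`exists_borel_expansion`).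

If this valuation were trivial on `E`, unipotents would fix `E` pointwise. So it is nontrivial
there, its residues on `E` are constants (`exists_algebraMap_eq_coeff_zero`), and the torus `Fˣ`
acts on the cotangent line by a character into `K` (`exists_character`), injective because `q - 1`
is odd. Thus `K` contains a primitive `(q - 1)`-st root of unity, hence a copy of `F`
(`nonempty_ringHom_of_injective_units`). -/

noncomputable section

namespace EssDim

/-! ### Symmetric algebras and the action on rational functions -/

section

section SymmetricAlgebra

variable {K M : Type*} [Field K] [AddCommGroup M] [Module K M]

instance uniqueFactorizationMonoid_symmetricAlgebra :
    UniqueFactorizationMonoid (SymmetricAlgebra K M) :=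
  (SymmetricAlgebra.equivMvPolynomial
    (Module.Free.chooseBasis K M)).symm.toMulEquiv.uniqueFactorizationMonoid inferInstance

theorem exists_algebraMap_eq_of_isUnit {r : SymmetricAlgebra K M} (hr : IsUnit r) :
    ∃ c : K, algebraMap K _ c = r := by
  let e := SymmetricAlgebra.equivMvPolynomial (Module.Free.chooseBasis K M)
  obtain ⟨c, -, hc⟩ := MvPolynomial.isUnit_iff_eq_C_of_isReduced.mp (hr.map e)
  refine ⟨c, e.injective ?_⟩
  rw [hc, AlgEquiv.commutes]
  rfl

/-- A field of rational functions over `K` contains no algebraic elements but the constants. -/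
theorem exists_algebraMap_eq_of_isAlgebraic {x : FractionRing (SymmetricAlgebra K M)}
    (hx : IsAlgebraic K x) : ∃ c : K, algebraMap K _ c = x := by
  -- `K[V]` is integrally closed, so an algebraic `x` and its inverse both lie in it; then `x` is a
  -- unit, hence constant.
  have key : ∀ y : FractionRing (SymmetricAlgebra K M), IsAlgebraic K y →
      ∃ r, algebraMap (SymmetricAlgebra K M) _ r = y := fun y hy =>
    IsIntegrallyClosed.isIntegral_iff.mp (hy.isIntegral.tower_top (A := SymmetricAlgebra K M))
  rcases eq_or_ne x 0 with rfl | h0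
  · exact ⟨0, map_zero _⟩
  obtain ⟨r, rfl⟩ := key x hx
  obtain ⟨s, hs⟩ := key _ hx.inv
  have hrs : r * s = 1 := by
    apply IsFractionRing.injective (SymmetricAlgebra K M) (FractionRing (SymmetricAlgebra K M))
    rw [map_mul, hs, map_one, mul_inv_cancel₀ h0]
  obtain ⟨c, rfl⟩ := exists_algebraMap_eq_of_isUnit (IsUnit.of_mul_eq_one s hrs)
  exact ⟨c, IsScalarTower.algebraMap_apply _ _ _ _⟩

theorem ι_injective (K M : Type*) [Field K] [AddCommGroup M] [Module K M] :
    Function.Injective (SymmetricAlgebra.ι K M) := by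
  let b := Module.Free.chooseBasis K M
  have hl : LinearIndependent K (MvPolynomial.X (R := K) (σ := Module.Free.ChooseBasisIndex K M)) :=
    MvPolynomial.linearIndependent_X _ _
  have h : Function.Injective (b.constr K (MvPolynomial.X (R := K))) := by
    rw [Module.Basis.constr_def]
    intro x y hxy
    simp only [LinearMap.comp_apply, Finsupp.lmapDomain_apply] at hxy
    apply b.repr.injective
    apply hl
    simpa [Finsupp.linearCombination_mapDomain] using hxy
  intro x y hxy
  apply h
  rw [← SymmetricAlgebra.lift_ι_apply (b.constr K (MvPolynomial.X (R := K))) x, hxy,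
    SymmetricAlgebra.lift_ι_apply]

end SymmetricAlgebra

variable {K : Type*} [Field K] {G : Type*} [Group G] {V : Type*} [AddCommGroup V] [Module K V]

theorem polyAction_ι (ρ : Representation K G V) (g : G) (f : Module.Dual K V) :
    polyAction ρ g (SymmetricAlgebra.ι K _ f) = SymmetricAlgebra.ι K _ (ρ.dual g f) :=
  SymmetricAlgebra.lift_ι_apply _ _

theorem fieldAction_algebraMap (ρ : Representation K G V) (g : G) (f : PolyRing K V) :
    fieldAction ρ g (algebraMap _ _ f) = algebraMap _ (FunField K V) (polyAction ρ g f) :=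
  IsFractionRing.fieldEquivOfAlgEquiv_algebraMap K _ _ _ f

theorem fieldAction_injective (ρ : Representation K G V)
    (hρ : Function.Injective ρ) : Function.Injective (fieldAction ρ) := by
  rw [injective_iff_map_eq_one]
  intro g hg
  have h1 : ρ.dual g = 1 := by
    ext1 f
    have := fieldAction_algebraMap ρ g (SymmetricAlgebra.ι K _ f)
    rw [hg, polyAction_ι] at this
    exact (ι_injective K _ (IsFractionRing.injective (PolyRing K V) (FunField K V) this)).symm
  have h2 : ρ g⁻¹ = 1 := by
    ext v
    rw [← sub_eq_zero, ← Module.forall_dual_apply_eq_zero_iff K]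
    intro f
    have : f (ρ g⁻¹ v) = f v := LinearMap.congr_fun (LinearMap.congr_fun h1 f) v
    simp [this]
  have := hρ (h2.trans (map_one ρ).symm)
  simpa using this

end

/-! ### A faithful subfield of degree one, when `F` embeds in `K` -/

section

open IntermediateField Matrix

theorem trdeg_adjoin_simple {K L : Type*} [Field K] [Field L] [Algebra K L] {t : L}
    (ht : Transcendental K t) : Algebra.trdeg K K⟮t⟯ = 1 := by
  set x : Unit → K⟮t⟯ := fun _ => AdjoinSimple.gen K t
  have hx : Transcendental K (AdjoinSimple.gen K t) := by
    intro h
    exact ht (by simpa using h.algebraMap (A := L))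
  have hai : AlgebraicIndependent K x := algebraicIndependent_unique_type_iff.mpr hx
  have hb : IsTranscendenceBasis K x := by
    rw [isTranscendenceBasis_iff_algebraicIndependent_isAlgebraic]
    refine ⟨hai, ⟨?_⟩⟩
    have hmem : ∀ r : Polynomial K,
        Polynomial.aeval (AdjoinSimple.gen K t) r ∈ Algebra.adjoin K (Set.range x) := by
      intro r
      rw [Set.range_const]
      exact Polynomial.aeval_mem_adjoin_singleton K _
    rintro ⟨y, hy⟩
    obtain ⟨r, s, hrs⟩ := (mem_adjoin_simple_iff K y).mp hy
    have : (⟨y, hy⟩ : K⟮t⟯) = Polynomial.aeval (AdjoinSimple.gen K t) r *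
        (Polynomial.aeval (AdjoinSimple.gen K t) s)⁻¹ := by
      apply Subtype.ext
      push_cast
      rw [hrs, div_eq_mul_inv]
      simp [← IntermediateField.aeval_coe]
    rw [this]
    exact (isAlgebraic_algebraMap (⟨_, hmem r⟩ : Algebra.adjoin K (Set.range x))).mul
      (isAlgebraic_algebraMap (⟨_, hmem s⟩ : Algebra.adjoin K (Set.range x))).inv
  have := hb.lift_cardinalMk_eq_trdeg
  simpa using this.symm

/-- Speiser's lemma in the form needed here: a two-dimensional representation over the base field
occurs in any field with a faithful group action. -/
theorem exists_equivariant_vector {K L G : Type*} [Field K] [Field L] [Algebra K L] [Group G]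
    [Finite G] (φ : G →* (L ≃ₐ[K] L)) (hφ : Function.Injective φ)
    (A : G →* Matrix (Fin 2) (Fin 2) K) :
    ∃ v : Fin 2 → L, v ≠ 0 ∧ ∀ g, (fun i => φ g (v i)) = (A g⁻¹).map (algebraMap K L) *ᵥ v := by
  classical
  have := Fintype.ofFinite G
  -- Average of the first column of `A` against the orbit of `c`; equivariance is a reindexing of
  -- the sum.
  let w (c : L) : Fin 2 → L := fun i => ∑ h : G, algebraMap K L (A h i 0) * φ h c
  have hw : ∀ c g, (fun i => φ g (w c i)) = (A g⁻¹).map (algebraMap K L) *ᵥ w c := by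
    intro c g
    ext i
    simp only [w, map_sum, map_mul, AlgEquiv.commutes, Matrix.mulVec, dotProduct, Matrix.map_apply,
      Finset.mul_sum]
    rw [Finset.sum_comm]
    refine Fintype.sum_equiv (Equiv.mulLeft g) _ _ fun h => ?_
    have : A h = A g⁻¹ * A (g * h) := by rw [← map_mul, inv_mul_cancel_left]
    rw [this, Matrix.mul_apply, map_sum, Finset.sum_mul]
    refine Finset.sum_congr rfl fun j _ => ?_
    simp only [map_mul, Equiv.coe_mulLeft, AlgEquiv.mul_apply, mul_assoc]
  suffices ∃ c, w c ≠ 0 by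
    obtain ⟨c, hc⟩ := this
    exact ⟨w c, hc, hw c⟩
  by_contra! hcon
  -- By Dedekind's independence of characters, vanishing for every `c` would force all coefficients
  -- `A h 0 0` to be zero, but the one at `h = 1` is 1.
  have hli := (linearIndependent_monoidHom L L).comp
    (fun h : G => ((φ h : L ≃ₐ[K] L) : L →* L)) (fun a b hab => hφ <| by
      ext x; exact DFunLike.congr_fun hab x)
  have := Fintype.linearIndependent_iff.mp hli (fun h => algebraMap K L (A h 0 0)) (by
    ext c
    simpa [w, Algebra.smul_def] using congrFun (hcon c) 0) 1
  simp at this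

/-- The group `SL₂(F)` acts faithfully on `K(t)` by homographies when `F ⊆ K` has
characteristic two; Speiser's lemma embeds this action into any other faithful one. -/
theorem exists_faithful_subfield_trdeg_one {K L F : Type*} [Field K] [CharP K 2] [Field L]
    [Algebra K L] [Field F] [Finite F] (hL : ∀ x : L, IsAlgebraic K x → ∃ c, algebraMap K L c = x)
    (φ : SpecialLinearGroup (Fin 2) F →* (L ≃ₐ[K] L)) (hφ : Function.Injective φ) (ι : F →+* K) :
    ∃ E : IntermediateField K L, IsFaithfulGSubfield φ E ∧ Algebra.trdeg K E = 1 := by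
  have : Finite (SpecialLinearGroup (Fin 2) F) := Subtype.finite
  let A : SpecialLinearGroup (Fin 2) F →* Matrix (Fin 2) (Fin 2) K :=
    { toFun := fun g => (g : Matrix (Fin 2) (Fin 2) F).map ι
      map_one' := by simp
      map_mul' := fun g h => by simp [Matrix.map_mul] }
  obtain ⟨v, hv0, hv⟩ := exists_equivariant_vector φ hφ A
  set x := v 0
  set y := v 1
  let κ : F →+* L := (algebraMap K L).comp ι
  have hgx : ∀ g, φ g⁻¹ x = κ (g 0 0) * x + κ (g 0 1) * y := by
    intro g
    have := congrFun (hv g⁻¹) 0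
    simpa [A, Matrix.mulVec, dotProduct, Fin.sum_univ_two, κ] using this
  have hgy : ∀ g, φ g⁻¹ y = κ (g 1 0) * x + κ (g 1 1) * y := by
    intro g
    have := congrFun (hv g⁻¹) 1
    simpa [A, Matrix.mulVec, dotProduct, Fin.sum_univ_two, κ] using this
  let upper : SpecialLinearGroup (Fin 2) F := ⟨!![1, 1; 0, 1], by simp⟩
  let lower : SpecialLinearGroup (Fin 2) F := ⟨!![1, 0; 1, 1], by simp⟩
  have hy0 : y ≠ 0 := by
    intro h
    have hlow := hgy lower
    have h1 : x = 0 := by simpa [lower, h] using hlow.symm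
    apply hv0
    ext i
    fin_cases i
    · exact h1
    · exact h
  set t := x / y with ht
  have hgt : ∀ g, φ g⁻¹ t = (κ (g 0 0) * t + κ (g 0 1)) / (κ (g 1 0) * t + κ (g 1 1)) := by
    intro g
    rw [ht, map_div₀, hgx, hgy, ← mul_div_mul_right _ (κ (g 1 0) * (x / y) + κ (g 1 1)) hy0]
    congr 1 <;> field_simp
  -- An algebraic `t` would be a constant, hence fixed, whereas `upper` sends `t` to `t + 1`.
  have htr : Transcendental K t := by
    intro h
    obtain ⟨c, hc⟩ := hL t h
    have h1 := hgt upper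
    rw [← hc, AlgEquiv.commutes] at h1
    simp [upper] at h1
  refine ⟨K⟮t⟯, ⟨?_, ?_⟩, trdeg_adjoin_simple htr⟩
  · intro g z hz
    have hle : K⟮t⟯ ≤ K⟮t⟯.comap (φ g : L →ₐ[K] L) := by
      rw [adjoin_simple_le_iff]
      change φ g t ∈ K⟮t⟯
      have hκ : ∀ a, κ a ∈ K⟮t⟯ := fun a => K⟮t⟯.algebraMap_mem (ι a)
      have htt := mem_adjoin_simple_self K t
      rw [← inv_inv g, hgt]
      exact div_mem (add_mem (mul_mem (hκ _) htt) (hκ _)) (add_mem (mul_mem (hκ _) htt) (hκ _))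
    exact hle hz
  · intro g hg
    have h1 : φ g t = t := hg t (mem_adjoin_simple_self K t)
    have h2 : φ g⁻¹ t = t := by
      conv_lhs => rw [← h1]
      rw [map_inv]
      exact (φ g).symm_apply_apply t
    rw [hgt] at h2
    have hne : κ (g 1 0) * t + κ (g 1 1) ≠ 0 := by
      intro h0
      rw [h0, div_zero] at h2
      exact htr (h2 ▸ isAlgebraic_zero)
    rw [div_eq_iff hne] at h2
    -- The fixed-point equation of the homography. As `t` is transcendental, all its coefficients
    -- vanish and `g` is scalar.
    let p : Polynomial K := .C (ι (g 1 0)) * .X ^ 2 + .C (ι (g 1 1) - ι (g 0 0)) * .X -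
      .C (ι (g 0 1))
    have hp : p = 0 := by
      by_contra hp0
      refine htr ⟨p, hp0, ?_⟩
      simp only [p, map_add, map_sub, map_mul, Polynomial.aeval_C, Polynomial.aeval_X, map_pow]
      change κ (g 1 0) * t ^ 2 + (κ (g 1 1) - κ (g 0 0)) * t - κ (g 0 1) = 0
      linear_combination -h2
    have hc0 := congrArg (Polynomial.coeff · 0) hp
    have hc1 := congrArg (Polynomial.coeff · 1) hp
    have hc2 := congrArg (Polynomial.coeff · 2) hp
    simp [p, Polynomial.coeff_X, Polynomial.coeff_C, sub_eq_zero] at hc0 hc1 hc2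
    have hdet := g.det_coe
    have : CharP F 2 := ι.charP ι.injective 2
    rw [Matrix.det_fin_two, hc0, ι.injective hc1] at hdet
    have hone : g 0 0 = 1 := by
      have h2 : (2 : F) = 0 := CharTwo.two_eq_zero
      rw [← sub_eq_zero, ← sq_eq_zero_iff]
      linear_combination hdet + h2 * (1 - g 0 0)
    ext i j
    fin_cases i <;> fin_cases j
    · simpa using hone
    · simpa using hc0
    · simpa using hc2
    · simpa [ι.injective hc1] using hone

end

/-! ### Residues of a nontrivial valuation in transcendence degree one -/

section

open IntermediateField

section Valuation

variable {M : Type*} [Field M]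

theorem exists_ofPowerSeries_eq {f : LaurentSeries M} (hf : 0 ≤ f.order) :
    ∃ g : PowerSeries M, HahnSeries.ofPowerSeries ℤ M g = f := by
  obtain ⟨n, hn⟩ := Int.eq_ofNat_of_zero_le hf
  exact ⟨PowerSeries.X ^ n * f.powerSeriesPart, LaurentSeries.X_order_mul_powerSeriesPart hn.symm⟩

theorem order_ofPowerSeries_nonneg (g : PowerSeries M) :
    0 ≤ (HahnSeries.ofPowerSeries ℤ M g).order := by
  by_contra! h
  have h0 : HahnSeries.ofPowerSeries ℤ M g ≠ 0 := by
    rintro h0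
    simp [h0] at h
  apply h0
  rw [← HahnSeries.coeff_order_eq_zero, PowerSeries.coeff_coe, if_pos h]

theorem coeff_zero_ofPowerSeries (g : PowerSeries M) :
    (HahnSeries.ofPowerSeries ℤ M g).coeff 0 = PowerSeries.constantCoeff g := by
  simpa using LaurentSeries.coeff_coe_powerSeries g 0

theorem order_inv {f : LaurentSeries M} (hf : f ≠ 0) : (f⁻¹).order = -f.order := by
  have := HahnSeries.order_mul hf (inv_ne_zero hf)
  rw [mul_inv_cancel₀ hf, HahnSeries.order_one] at this
  linarith

theorem order_ofPowerSeries_eq_zero {g : PowerSeries M} (hg : PowerSeries.constantCoeff g ≠ 0) :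
    (HahnSeries.ofPowerSeries ℤ M g).order = 0 := by
  refine le_antisymm ?_ (order_ofPowerSeries_nonneg g)
  apply HahnSeries.order_le_of_coeff_ne_zero
  rwa [coeff_zero_ofPowerSeries]

theorem order_nonneg_of_isIntegral {f : LaurentSeries M} (hf : IsIntegral (PowerSeries M) f) :
    0 ≤ f.order := by
  obtain ⟨g, rfl⟩ := IsIntegrallyClosed.isIntegral_iff.mp hf
  exact order_ofPowerSeries_nonneg g

end Valuation

variable {K L M : Type*} [Field K] [Field L] [Algebra K L] [Field M] [Algebra K M]

/-- If the residue of `x` were transcendental, the valuation would be trivial on `K(x)`. Since `L`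
is algebraic over `K(x)`, it would be trivial on `L` as well, contradicting the existence of `p`. -/
theorem exists_algebraMap_eq_coeff_zero
    (hM : ∀ x : M, IsAlgebraic K x → ∃ c, algebraMap K M c = x)
    (Φ : L →+* LaurentSeries M)
    (hΦ : ∀ c, Φ (algebraMap K L c) = HahnSeries.C (algebraMap K M c))
    (hL : Algebra.trdeg K L = 1) {p : L} (hp : (Φ p).order ≠ 0)
    {x : L} (hx : 0 ≤ (Φ x).order) :
    ∃ c, algebraMap K M c = (Φ x).coeff 0 := by
  apply hM
  by_contra htr
  obtain ⟨g, hg⟩ := exists_ofPowerSeries_eq hx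
  rw [← hg, coeff_zero_ofPowerSeries] at htr
  have haeval : ∀ r : Polynomial K, Φ (Polynomial.aeval x r) =
      HahnSeries.ofPowerSeries ℤ M (Polynomial.aeval g r) := by
    intro r
    have hK : Φ.comp (algebraMap K L) =
        (HahnSeries.ofPowerSeries ℤ M).comp (algebraMap K (PowerSeries M)) := by
      ext1 c
      simp [PowerSeries.algebraMap_apply, hΦ]
    rw [Polynomial.aeval_def, Polynomial.aeval_def, Polynomial.hom_eval₂,
      Polynomial.hom_eval₂, hg, hK]
  have hconst : ∀ r : Polynomial K, r ≠ 0 → PowerSeries.constantCoeff (Polynomial.aeval g r) ≠ 0 := by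
    intro r hr h
    refine htr ⟨r, hr, ?_⟩
    rw [← h, Polynomial.aeval_def, Polynomial.aeval_def, Polynomial.hom_eval₂]
    rfl
  -- The zero polynomial is covered because the zero series has order 0 by convention.
  have hord : ∀ r : Polynomial K, (Φ (Polynomial.aeval x r)).order = 0 := by
    intro r
    rcases eq_or_ne r 0 with rfl | hr
    · simp
    · rw [haeval]
      exact order_ofPowerSeries_eq_zero (hconst r hr)
  have hxt : Transcendental K x := by
    rintro ⟨r, hr, h⟩
    apply hconst r hr
    have h2 := haeval r
    rw [h, map_zero, eq_comm, map_eq_zero_iff _ HahnSeries.ofPowerSeries_injective] at h2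
    rw [h2, map_zero]
  have hord' : ∀ y ∈ K⟮x⟯, (Φ y).order = 0 := by
    intro y hy
    obtain ⟨r, s, rfl⟩ := (mem_adjoin_simple_iff K y).mp hy
    rcases eq_or_ne (Polynomial.aeval x r) 0 with hr | hr
    · simp [hr]
    rcases eq_or_ne (Polynomial.aeval x s) 0 with hs | hs
    · simp [hs]
    rw [div_eq_mul_inv, map_mul, map_inv₀, HahnSeries.order_mul (by simpa using hr)
      (inv_ne_zero (by simpa using hs)), order_inv (by simpa using hs), hord, hord]
    simp
  have hb : IsTranscendenceBasis K (fun _ : Unit => x) := by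
    apply AlgebraicIndependent.isTranscendenceBasis_of_lift_trdeg_le_of_finite
    · exact algebraicIndependent_unique_type_iff.mpr hxt
    · simp [hL]
  -- An equation for `y` over `K(x)` expands to one with power series coefficients, and power series
  -- are integrally closed. Applied to both `p` and `p⁻¹`, this yields order zero.
  have hge : ∀ y, 0 ≤ (Φ y).order := by
    intro y
    apply order_nonneg_of_isIntegral
    have := hb.isAlgebraic_field
    rw [Set.range_const] at this
    obtain ⟨P, hP, hPy⟩ := (this.isAlgebraic y).isIntegral
    let ψ : K⟮x⟯ →+* LaurentSeries M := Φ.comp (algebraMap K⟮x⟯ L)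
    obtain ⟨Q, hQ, -, hQm⟩ := Polynomial.lifts_and_natDegree_eq_and_monic
      (f := HahnSeries.ofPowerSeries ℤ M) (p := P.map ψ) (by
        rw [Polynomial.lifts_iff_coeff_lifts]
        intro n
        rw [Polynomial.coeff_map]
        exact exists_ofPowerSeries_eq (hord' _ (P.coeff n).2).ge) (hP.map ψ)
    refine ⟨Q, hQm, ?_⟩
    have hcoe : algebraMap (PowerSeries M) (LaurentSeries M) = HahnSeries.ofPowerSeries ℤ M := by
      rw [RingHom.ext_iff]
      exact congrFun LaurentSeries.coe_algebraMap
    rw [← Polynomial.eval_map, hcoe, hQ, Polynomial.eval_map,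
      ← Polynomial.hom_eval₂, hPy, map_zero]
  have hp0 : Φ p ≠ 0 := by
    intro h
    simp [h] at hp
  have h1 := hge p
  have h2 := hge p⁻¹
  rw [map_inv₀, order_inv hp0] at h2
  omega

end

/-! ### The character on the cotangent line of a place -/

section

section Valuation

variable {M : Type*} [Field M]

theorem order_zpow (f : LaurentSeries M) (k : ℤ) : (f ^ k).order = k * f.order := by
  rcases eq_or_ne f 0 with rfl | hf
  · rcases eq_or_ne k 0 with rfl | hk
    · simp
    · simp [zero_zpow k hk]
  cases k with
  | ofNat n => simp
  | negSucc n =>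
    rw [zpow_negSucc, order_inv (pow_ne_zero _ hf), HahnSeries.order_pow, Int.negSucc_eq]
    simp only [nsmul_eq_mul]
    push_cast
    ring

/-- The leading coefficient of a Laurent series, as a multiplicative map. -/
def leadingCoeffHom (M : Type*) [Field M] : LaurentSeries M →*₀ M where
  toFun f := f.leadingCoeff
  map_zero' := HahnSeries.leadingCoeff_zero
  map_one' := HahnSeries.leadingCoeff_one
  map_mul' f g := HahnSeries.leadingCoeff_mul f g

end Valuation

variable {K L M : Type*} [Field K] [Field L] [Algebra K L] [Field M] [Algebra K M]

section

variable (Φ : L →+* LaurentSeries M)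

/-- The leading coefficient of the expansion of an element of `L` along `Φ`. -/
def leadHom : L →*₀ M := (leadingCoeffHom M).comp Φ.toMonoidWithZeroHom

theorem leadHom_apply (x : L) : leadHom Φ x = (Φ x).coeff (Φ x).order :=
  HahnSeries.leadingCoeff_eq

theorem order_div {x y : L} (hx : x ≠ 0) (hy : y ≠ 0) :
    (Φ (x / y)).order = (Φ x).order - (Φ y).order := by
  have hx' : Φ x ≠ 0 := by simpa using hx
  have hy' : Φ y ≠ 0 := by simpa using hy
  rw [div_eq_mul_inv, map_mul, map_inv₀, HahnSeries.order_mul hx' (inv_ne_zero hy'), order_inv hy',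
    sub_eq_add_neg]

/-- A nontrivial discrete valuation has a uniformizer. -/
theorem exists_uniformizer {p : L} (hp : (Φ p).order ≠ 0) :
    ∃ t : L, t ≠ 0 ∧ ∀ x ≠ 0, ∃ k : ℤ, (Φ (x / t ^ k)).order = 0 := by
  classical
  have hex : ∃ n : ℕ, 0 < n ∧ ∃ t, (Φ t).order = n := by
    have hp0 : Φ p ≠ 0 := by
      intro h
      simp [h] at hp
    rcases lt_or_gt_of_ne hp with h | h
    · refine ⟨(-(Φ p).order).toNat, by omega, p⁻¹, ?_⟩
      rw [map_inv₀, order_inv hp0]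
      omega
    · exact ⟨(Φ p).order.toNat, by omega, p, by omega⟩
  obtain ⟨hpos, t, ht⟩ := Nat.find_spec hex
  set e := Nat.find hex with he
  have ht0 : t ≠ 0 := by
    rintro rfl
    simp at ht
    omega
  refine ⟨t, ht0, fun x hx => ⟨(Φ x).order / e, ?_⟩⟩
  have ho := order_div Φ hx (zpow_ne_zero ((Φ x).order / e) ht0)
  rw [map_zpow₀, order_zpow, ht, mul_comm] at ho
  have h1 := Int.emod_add_mul_ediv (Φ x).order e
  have h2 := Int.emod_nonneg (Φ x).order (b := e) (by omega)
  have h3 := Int.emod_lt_of_pos (Φ x).order (b := e) (by omega)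
  by_contra hne
  -- The remainder of the order modulo the least positive order `e` would be a smaller positive
  -- order.
  refine Nat.find_min hex (m := ((Φ x).order % e).toNat) (by omega) ⟨by omega, x / t ^ ((Φ x).order / (e : ℤ)), ?_⟩
  rw [ho]
  omega

end

/-- A group acting on a field of transcendence degree one and fixing a nontrivial place with
residue field `K` acts on the cotangent line of the place by a character, and
this character detects elements of order prime to the characteristic. -/
theorem exists_character {H : Type*} [Group H]
    (hM : ∀ x : M, IsAlgebraic K x → ∃ c, algebraMap K M c = x)
    (Φ : L →+* LaurentSeries M)
    (hΦ : ∀ c, Φ (algebraMap K L c) = HahnSeries.C (algebraMap K M c))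
    (hL : Algebra.trdeg K L = 1) {p : L} (hp : (Φ p).order ≠ 0)
    (ψ : H →* (L →ₐ[K] L)) (hψ : ∀ h x, (Φ (ψ h x)).order = (Φ x).order) :
    ∃ χ : H →* K, ∀ h, ∀ n : ℕ, (n : K) ≠ 0 → h ^ n = 1 → χ h = 1 → ψ h = 1 := by
  have hψ0 : ∀ h x, x ≠ 0 → ψ h x ≠ 0 := fun h x hx => by simpa using hx
  have hres : ∀ x, 0 ≤ (Φ x).order → ∃ c, algebraMap K M c = (Φ x).coeff 0 := fun x hx =>
    exists_algebraMap_eq_coeff_zero hM Φ hΦ hL hp hx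
  -- With `c` in `K` the residue of `x`, the difference `x - c` has positive order or is zero, and
  -- `ψ h` preserves this while fixing `c`.
  have hfix : ∀ h x, (Φ x).order = 0 → leadHom Φ (ψ h x) = leadHom Φ x := by
    intro h x hx
    rw [leadHom_apply, leadHom_apply, hψ, hx]
    obtain ⟨c, hc⟩ := hres x hx.ge
    obtain ⟨g, hg⟩ := exists_ofPowerSeries_eq hx.ge
    set y := x - algebraMap K L c with hy
    have hΦy : Φ y = HahnSeries.ofPowerSeries ℤ M (g - PowerSeries.C (algebraMap K M c)) := by
      rw [hy, map_sub, hΦ, map_sub, hg, HahnSeries.ofPowerSeries_C]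
    have hy1 : 0 ≤ (Φ y).order := hΦy ▸ order_ofPowerSeries_nonneg _
    have hy2 : (Φ y).coeff 0 = 0 := by
      rw [hy, map_sub, hΦ, HahnSeries.coeff_sub, ← hc]
      simp
    have hy3 : (Φ (ψ h y)).coeff 0 = 0 := by
      rcases eq_or_ne y 0 with h0 | h0
      · simp [h0]
      apply HahnSeries.coeff_eq_zero_of_lt_order
      rw [hψ]
      refine lt_of_le_of_ne hy1 fun h1 => ?_
      rw [h1, HahnSeries.coeff_order_eq_zero] at hy2
      exact h0 (by simpa using hy2)
    rw [hy, map_sub, AlgHom.commutes, map_sub, hΦ, HahnSeries.coeff_sub, sub_eq_zero] at hy3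
    rw [hy3, ← hc]
    simp
  obtain ⟨t, ht0, ht⟩ := exists_uniformizer Φ hp
  have hquot : ∀ h x, x ≠ 0 → (Φ (ψ h x / x)).order = 0 := fun h x hx => by
    rw [order_div Φ (hψ0 h x hx) hx, hψ, sub_self]
  have hchar : ∀ h, ∃ c, algebraMap K M c = leadHom Φ (ψ h t / t) := fun h => by
    rw [leadHom_apply, hquot h t ht0]
    exact hres _ (hquot h t ht0).ge
  choose χ hχ using hchar
  have hinj := (algebraMap K M).injective
  refine ⟨{ toFun := χ, map_one' := ?_, map_mul' := ?_ }, ?_⟩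
  · apply hinj
    rw [hχ, map_one, map_one, AlgHom.one_apply, div_self ht0, map_one]
  · intro g h
    apply hinj
    have hgh : ψ (g * h) t / t = ψ g t / t * ψ g (ψ h t / t) := by
      rw [map_mul, AlgHom.mul_apply, map_div₀, mul_comm, div_mul_div_cancel₀ (hψ0 g t ht0)]
    rw [map_mul, hχ, hχ, hχ, hgh, map_mul, hfix g _ (hquot h t ht0)]
  intro h n hn hhn hχh
  change χ h = 1 at hχh
  have h1 : leadHom Φ (ψ h t) = leadHom Φ t := by
    have := hχ h
    rw [hχh, map_one, map_div₀, eq_comm, div_eq_one_iff_eq (by simpa using ht0)] at this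
    exact this
  have hlead : ∀ x, leadHom Φ (ψ h x) = leadHom Φ x := by
    intro x
    rcases eq_or_ne x 0 with rfl | hx
    · simp
    obtain ⟨k, hk⟩ := ht x hx
    have hxk : x = x / t ^ k * t ^ k := by rw [div_mul_cancel₀ _ (zpow_ne_zero _ ht0)]
    rw [hxk, map_mul, map_mul, hfix h _ hk, map_zpow₀, map_zpow₀, h1, map_mul, map_zpow₀]
  have hpow : ∀ (i : ℕ) x, leadHom Φ (ψ (h ^ i) x) = leadHom Φ x := by
    intro i
    induction i with
    | zero => simp
    | succ i ih =>
      intro x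
      rw [pow_succ, map_mul, AlgHom.mul_apply, ih, hlead]
  ext x
  by_contra hne
  set y := ψ h x - x with hy
  have hy0 : y ≠ 0 := sub_ne_zero.mpr hne
  -- The sum telescopes to `h ^ n x - x = 0`, yet all `n` terms share the order and leading
  -- coefficient of `y`; so `n` times that coefficient vanishes.
  have hsum : ∑ i ∈ Finset.range n, ψ (h ^ i) y = 0 := by
    have : ∀ i, ψ (h ^ i) y = ψ (h ^ (i + 1)) x - ψ (h ^ i) x := fun i => by
      rw [hy, map_sub, pow_succ, map_mul, AlgHom.mul_apply]
    simp_rw [this]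
    rw [Finset.sum_range_sub (fun i => ψ (h ^ i) x), hhn, pow_zero, sub_self]
  have hcoeff := congrArg (fun z => (Φ z).coeff (Φ y).order) hsum
  simp only [map_sum, map_zero, HahnSeries.coeff_zero, HahnSeries.coeff_sum] at hcoeff
  have hterm : ∀ i ∈ Finset.range n, (Φ (ψ (h ^ i) y)).coeff (Φ y).order = leadHom Φ y := by
    intro i _
    rw [← hpow i y, leadHom_apply, hψ]
  rw [Finset.sum_congr rfl hterm, Finset.sum_const, Finset.card_range, nsmul_eq_mul, mul_eq_zero,
    map_eq_zero] at hcoeff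
  rcases hcoeff with h2 | h2
  · apply hn
    apply hinj
    rw [map_natCast, h2, map_zero]
  · exact hy0 h2

end

/-! ### Filtrations and weighted bases -/

section

variable {K M : Type*} [Field K] [AddCommGroup M] [Module K M]

/-- A finite exhaustive filtration of a vector space has an adapted basis; `h` records the step
at which a basis vector enters. -/
theorem exists_basis_of_filtration (N : ℕ → Submodule K M) (hN : Monotone N) (h0 : N 0 = ⊥) {k : ℕ}
    (hk : N k = ⊤) :
    ∃ (s : Set M) (b : Module.Basis s K M) (h : s → ℕ), (∀ i, h i ≤ k) ∧ (∀ i, b i ∈ N (h i)) ∧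
      ∀ j, ∀ m ∈ N j, ∀ i, b.repr m i ≠ 0 → h i ≤ j := by
  classical
  have key : ∀ k : ℕ, ∃ (s : Set M) (h : M → ℕ), LinearIndepOn K id s ∧ (∀ i, h i ≤ k) ∧
      ∀ j ≤ k, Submodule.span K {x ∈ s | h x ≤ j} = N j := by
    intro k
    induction k with
    | zero =>
      refine ⟨∅, fun _ => 0, linearIndepOn_empty _ _, fun _ => le_rfl, fun j hj => ?_⟩
      obtain rfl : j = 0 := by omega
      simp [h0]
    | succ k ih =>
      obtain ⟨s, h, hs, hle, hspan⟩ := ih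
      have hsN : s ⊆ N (k + 1) := by
        intro x hx
        apply hN (Nat.le_succ k)
        rw [← hspan k le_rfl]
        exact Submodule.subset_span ⟨hx, hle x⟩
      refine ⟨hs.extend hsN, fun x => if x ∈ s then h x else k + 1, hs.linearIndepOn_extend hsN,
        fun i => ?_, fun j hj => ?_⟩
      · dsimp only
        split_ifs
        · exact (hle i).trans (Nat.le_succ k)
        · exact le_rfl
      · rcases hj.lt_or_eq with hj | rfl
        · rw [← hspan j (by omega)]
          congr 1
          ext x
          simp only [Set.mem_ofPred_eq]
          constructor
          · rintro ⟨hx, hxj⟩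
            split_ifs at hxj with hxs
            · exact ⟨hxs, hxj⟩
            · omega
          · rintro ⟨hx, hxj⟩
            exact ⟨hs.subset_extend hsN hx, by rwa [if_pos hx]⟩
        · have : {x ∈ hs.extend hsN | (if x ∈ s then h x else k + 1) ≤ k + 1} = hs.extend hsN := by
            refine Set.sep_eq_self_iff_mem_true.mpr fun x _ => ?_
            split_ifs
            · exact (hle x).trans (Nat.le_succ k)
            · exact le_rfl
          rw [this]
          apply le_antisymm
          · exact Submodule.span_le.mpr (hs.extend_subset hsN)
          · intro x hx
            simpa using hs.subset_span_extend hsN hx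
  obtain ⟨s, h, hs, hle, hspan⟩ := key k
  let b : Module.Basis s K M := Module.Basis.mk (v := fun x : s => (x : M)) hs (by
    rw [Subtype.range_coe, ← hk, ← hspan k le_rfl]
    exact Submodule.span_mono fun x hx => hx.1)
  have hb : ∀ i, b i = i := fun i => Module.Basis.mk_apply _ _ i
  have hN' : ∀ j, j ≤ k → N j = Submodule.span K (b '' {i | h i ≤ j}) := by
    intro j hj
    rw [← hspan j hj]
    congr 1
    ext x
    simp [hb, and_comm]
  refine ⟨s, b, fun i => h i, fun i => hle i, fun i => ?_, fun j m hm i hi => ?_⟩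
  · rw [hN' _ (hle i)]
    exact Submodule.subset_span ⟨i, le_refl (h i), rfl⟩
  · rcases le_total k j with hkj | hkj
    · exact (hle i).trans hkj
    rw [hN' j hkj, b.mem_span_image] at hm
    exact hm (by simpa using hi)

variable {ι : Type*}

/-- The ascending filtration whose steps are the vectors that any product of `n` of the
operators `f i` kills. -/
def kernelFiltration (f : ι → Module.End K M) : ℕ → Submodule K M
  | 0 => ⊥
  | n + 1 => ⨅ i, (kernelFiltration f n).comap (f i)

variable {f : ι → Module.End K M}

theorem mem_kernelFiltration_succ {n : ℕ} {m : M} :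
    m ∈ kernelFiltration f (n + 1) ↔ ∀ i, f i m ∈ kernelFiltration f n := by
  simp [kernelFiltration]

theorem kernelFiltration_monotone : Monotone (kernelFiltration f) := by
  refine monotone_nat_of_le_succ fun n => ?_
  induction n with
  | zero => exact bot_le
  | succ n ih =>
    intro m hm
    rw [mem_kernelFiltration_succ] at hm ⊢
    exact fun i => ih (hm i)

theorem kernelFiltration_stable {g : Module.End K M} (hg : ∀ i, ∃ i', f i * g = g * f i') {n : ℕ}
    {m : M} (hm : m ∈ kernelFiltration f n) : g m ∈ kernelFiltration f n := by
  induction n generalizing m with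
  | zero =>
    obtain rfl : m = 0 := hm
    simp
  | succ n ih =>
    rw [mem_kernelFiltration_succ] at hm ⊢
    intro i
    obtain ⟨i', hi'⟩ := hg i
    rw [← Module.End.mul_apply, hi']
    exact ih (hm i')

theorem mem_kernelFiltration_of_prod {n : ℕ} {m : M}
    (h : ∀ l : List ι, l.length = n → (l.map f).prod m = 0) : m ∈ kernelFiltration f n := by
  induction n generalizing m with
  | zero => exact (Submodule.mem_bot K).mpr (by simpa using h [] rfl)
  | succ n ih =>
    rw [mem_kernelFiltration_succ]
    intro i
    refine ih fun l hl => ?_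
    simpa using h (l ++ [i]) (by simp [hl])

/-- Pigeonhole: a product of `Nat.card ι + 1` of the operators repeats one of them, and commuting
the two copies together gives zero. -/
theorem kernelFiltration_eq_top [Finite ι] (hcomm : ∀ i j, Commute (f i) (f j))
    (hsq : ∀ i, f i * f i = 0) : kernelFiltration f (Nat.card ι + 1) = ⊤ := by
  classical
  have := Fintype.ofFinite ι
  rw [eq_top_iff]
  intro m _
  refine mem_kernelFiltration_of_prod fun l hl => ?_
  have hnd : ¬ l.Nodup := fun hnd => by
    have := hnd.length_le_card
    rw [hl, Nat.card_eq_fintype_card] at this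
    omega
  obtain ⟨i, hi⟩ := List.exists_duplicate_iff_not_nodup.mpr hnd
  obtain ⟨l', hl'⟩ := (List.duplicate_iff_sublist.mp hi).exists_perm_append
  have hperm : (l.map f).Perm (([i, i] ++ l').map f) := hl'.map f
  rw [hperm.prod_eq']
  · simp [← mul_assoc, hsq]
  · rw [List.pairwise_map]
    exact List.pairwise_of_forall fun i j => hcomm i j

/-- Weights on a basis for which the commuting square-zero operators `f i` raise weights, while
operators normalizing the family do not lower them. -/
theorem exists_weighted_basis [Finite ι] (hcomm : ∀ i j, Commute (f i) (f j))
    (hsq : ∀ i, f i * f i = 0) :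
    ∃ (s : Set M) (b : Module.Basis s K M) (w : s → ℕ),
      (∀ g : Module.End K M, (∀ i, ∃ i', f i * g = g * f i') →
        ∀ a c, b.repr (g (b a)) c ≠ 0 → w a ≤ w c) ∧
      ∀ i a c, b.repr (f i (b a)) c ≠ 0 → w a < w c := by
  obtain ⟨s, b, h, hle, hmem, hrepr⟩ := exists_basis_of_filtration (kernelFiltration f)
    kernelFiltration_monotone rfl (kernelFiltration_eq_top hcomm hsq)
  -- The filtration step is reversed: the operators `f i` lower `h`, hence raise the weight.
  refine ⟨s, b, fun a => Nat.card ι + 1 - h a, fun g hg a c hac => ?_, fun i a c hac => ?_⟩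
  · have := hrepr _ _ (kernelFiltration_stable hg (hmem a)) c hac
    exact Nat.sub_le_sub_left this _
  · have h1 := hmem a
    have h2 := hle a
    rcases hn : h a with _ | n
    · rw [hn] at h1
      exact (b.ne_zero a h1).elim
    · rw [hn, mem_kernelFiltration_succ] at h1
      have := hrepr _ _ (h1 i) c hac
      have := hle c
      dsimp only
      omega

end

/-! ### Weighted Laurent expansion of rational functions -/

section

open Polynomial

section Weight

variable {K M ι : Type*} [Field K] [AddCommGroup M] [Module K M]
variable (b : Module.Basis ι K M) (w : ι → ℕ)

/-- The substitution `x_a ↦ s ^ w a • x_a` in the polynomial ring on the basis `x = b`. -/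
def weightHom : SymmetricAlgebra K M →ₐ[K] (SymmetricAlgebra K M)[X] :=
  SymmetricAlgebra.lift (b.constr K fun a => X ^ w a * C (SymmetricAlgebra.ι K M (b a)))

/-- Setting `s = 1` is a left inverse. -/
theorem weightHom_injective : Function.Injective (weightHom b w) := by
  have h : ((aeval (R := SymmetricAlgebra K M) (1 : SymmetricAlgebra K M)).restrictScalars K).comp
      (weightHom b w) = AlgHom.id K _ := by
    apply SymmetricAlgebra.algHom_ext
    apply b.ext
    intro a
    simp [weightHom, SymmetricAlgebra.lift_ι_apply]
  exact Function.LeftInverse.injective (DFunLike.congr_fun h)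

/-- Conjugating a linear substitution by the substitution `weightHom`. -/
def deform (g : Module.End K M) : (SymmetricAlgebra K M)[X] →ₐ[K] (SymmetricAlgebra K M)[X] :=
  eval₂AlgHom (SymmetricAlgebra.lift (b.constr K fun a => (b.repr (g (b a))).sum fun c k =>
    k • (X ^ (w c - w a) * C (SymmetricAlgebra.ι K M (b c))))) X fun _ => Commute.all _ _

theorem deform_X (g : Module.End K M) : deform b w g X = X := by
  simp [deform]

theorem deform_C_ι (g : Module.End K M) (a : ι) :
    deform b w g (C (SymmetricAlgebra.ι K M (b a))) = (b.repr (g (b a))).sum fun c k =>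
      k • (X ^ (w c - w a) * C (SymmetricAlgebra.ι K M (b c))) := by
  simp [deform, SymmetricAlgebra.lift_ι_apply]

variable {b w}

/-- The truncated exponent `w c - w a` is harmless: `hg` makes the matrix coefficient vanish
whenever `w c < w a`. -/
theorem deform_weightHom {g : Module.End K M}
    (hg : ∀ a c, b.repr (g (b a)) c ≠ 0 → w a ≤ w c) (f : SymmetricAlgebra K M) :
    deform b w g (weightHom b w f) =
      weightHom b w (SymmetricAlgebra.lift (SymmetricAlgebra.ι K M ∘ₗ g) f) := by
  suffices h : (deform b w g).comp (weightHom b w) =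
      (weightHom b w).comp (SymmetricAlgebra.lift (SymmetricAlgebra.ι K M ∘ₗ g)) from
    DFunLike.congr_fun h f
  apply SymmetricAlgebra.algHom_ext
  apply b.ext
  intro a
  change deform b w g (weightHom b w (SymmetricAlgebra.ι K M (b a))) =
    weightHom b w (SymmetricAlgebra.lift _ (SymmetricAlgebra.ι K M (b a)))
  rw [SymmetricAlgebra.lift_ι_apply, LinearMap.comp_apply, weightHom, SymmetricAlgebra.lift_ι_apply,
    SymmetricAlgebra.lift_ι_apply, b.constr_basis, map_mul, map_pow, deform_X, deform_C_ι,
    b.constr_apply, Finsupp.mul_sum]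
  refine Finsupp.sum_congr fun c hc => ?_
  have := hg a c (by simpa using hc)
  rw [mul_smul_comm, ← mul_assoc, ← pow_add, Nat.add_sub_cancel' this]

/-- At `s = 0` every strictly weight-raising term dies, and the diagonal coefficients of `g` are 1,
so the deformation specializes to the identity. -/
theorem coeff_zero_deform {g : Module.End K M}
    (hg : ∀ a c, b.repr ((g - 1) (b a)) c ≠ 0 → w a < w c) (F : (SymmetricAlgebra K M)[X]) :
    (deform b w g F).coeff 0 = F.coeff 0 := by
  let ε : (SymmetricAlgebra K M)[X] →ₐ[K] SymmetricAlgebra K M :=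
    (aeval (R := SymmetricAlgebra K M) (0 : SymmetricAlgebra K M)).restrictScalars K
  have hε : ∀ F, ε F = F.coeff 0 := fun F => by
    simp [ε, coeff_zero_eq_aeval_zero]
  rw [← hε, ← hε]
  suffices h : ε.comp (deform b w g) = ε from DFunLike.congr_fun h F
  apply Polynomial.algHom_ext'
  · apply SymmetricAlgebra.algHom_ext
    apply b.ext
    intro a
    change ε (deform b w g (C _)) = ε (C _)
    have hk : ∀ c, b.repr ((g - 1) (b a)) c = b.repr (g (b a)) c - b.repr (b a) c := fun c => by
      simp
    rw [deform_C_ι, map_finsuppSum, Finsupp.sum_eq_single a]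
    · have : b.repr (g (b a)) a = 1 := by
        by_contra hne
        refine (hg a a ?_).false
        rw [hk, b.repr_self, Finsupp.single_eq_same]
        exact sub_ne_zero.mpr hne
      simp [this]
    · intro c hc hca
      have := hg a c (by
        rw [hk, b.repr_self, Finsupp.single_eq_of_ne hca, sub_zero]
        exact hc)
      rw [map_smul, map_mul, map_pow, hε X, coeff_X_zero, zero_pow (by omega), zero_mul, smul_zero]
    · intro _
      simp
  · change ε (deform b w g X) = ε X
    rw [deform_X]

end Weight

section Expansion

variable {K M ι : Type*} [Field K] [AddCommGroup M] [Module K M]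
variable (L : Type*) [Field L] [Algebra (SymmetricAlgebra K M) L]
  [IsFractionRing (SymmetricAlgebra K M) L] (b : Module.Basis ι K M) (w : ι → ℕ)

/-- Laurent expansion of polynomials along the weight grading. -/
def polyExpansion : SymmetricAlgebra K M →+* LaurentSeries L :=
  (HahnSeries.ofPowerSeries ℤ _).comp <| (coeToPowerSeries.ringHom).comp <|
    (mapRingHom (algebraMap _ _)).comp (weightHom b w).toRingHom

theorem polyExpansion_injective : Function.Injective (polyExpansion L b w) := by
  refine HahnSeries.ofPowerSeries_injective.comp ?_
  refine (Polynomial.coe_injective _).comp ?_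
  exact (map_injective _ (IsFractionRing.injective _ _)).comp (weightHom_injective b w)

/-- Laurent expansion of rational functions along the weight grading. -/
def expansion : L →+* LaurentSeries L :=
  IsFractionRing.lift (polyExpansion_injective L b w)

theorem expansion_algebraMap (f : SymmetricAlgebra K M) :
    expansion L b w (algebraMap _ _ f) = polyExpansion L b w f :=
  IsFractionRing.lift_algebraMap _ _

theorem expansion_algebraMap_base [Algebra K L] [IsScalarTower K (SymmetricAlgebra K M) L] (c : K) :
    expansion L b w (algebraMap K _ c) = HahnSeries.C (algebraMap K _ c) := by
  rw [IsScalarTower.algebraMap_apply K (SymmetricAlgebra K M) L, expansion_algebraMap]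
  simp [polyExpansion, Polynomial.algebraMap_apply]

variable {b w}

theorem exists_weightHom_eq {f : SymmetricAlgebra K M} (hf : f ≠ 0) :
    ∃ (k : ℕ) (F : (SymmetricAlgebra K M)[X]), F.coeff 0 ≠ 0 ∧ weightHom b w f = X ^ k * F := by
  have h0 : weightHom b w f ≠ 0 := by
    rwa [map_ne_zero_iff _ (weightHom_injective b w)]
  obtain ⟨F, hF, hdvd⟩ := exists_eq_pow_rootMultiplicity_mul_and_not_dvd _ h0 0
  rw [map_zero, sub_zero] at hF hdvd
  exact ⟨_, F, by rwa [X_dvd_iff] at hdvd, hF⟩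

/-- Identifies the valuation with the lowest weight occurring in `f`, and the leading coefficient
with the part of `f` of that weight. -/
theorem order_expansion_of_eq {f : SymmetricAlgebra K M} {k : ℕ} {F : (SymmetricAlgebra K M)[X]}
    (hF : F.coeff 0 ≠ 0) (h : weightHom b w f = X ^ k * F) :
    (expansion L b w (algebraMap _ _ f)).order = k ∧
      leadHom (expansion L b w) (algebraMap _ _ f) = algebraMap _ _ (F.coeff 0) := by
  set g : PowerSeries L := ((F.map (algebraMap _ L) : L[X]) : PowerSeries L)
  have hg : PowerSeries.constantCoeff g = algebraMap _ _ (F.coeff 0) := by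
    simp [g, ← PowerSeries.coeff_zero_eq_constantCoeff_apply]
  have hg0 : PowerSeries.constantCoeff g ≠ 0 := by
    rw [hg]
    simpa using hF
  have hord := order_ofPowerSeries_eq_zero hg0
  have hg1 : HahnSeries.ofPowerSeries ℤ _ g ≠ 0 := by
    rw [map_ne_zero_iff _ HahnSeries.ofPowerSeries_injective]
    rintro h0
    simp [h0] at hg0
  have hexp : expansion L b w (algebraMap _ _ f) =
      HahnSeries.single (k : ℤ) 1 * HahnSeries.ofPowerSeries ℤ _ g := by
    rw [expansion_algebraMap]
    simp [polyExpansion, h, g, HahnSeries.ofPowerSeries_X, HahnSeries.single_pow]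
  have hs : (HahnSeries.single (k : ℤ) (1 : L)) ≠ 0 := by
    simp
  constructor
  · rw [hexp, HahnSeries.order_mul hs hg1, hord, HahnSeries.order_single one_ne_zero, add_zero]
  · rw [leadHom_apply, ← HahnSeries.leadingCoeff_eq, hexp, HahnSeries.leadingCoeff_mul,
      HahnSeries.leadingCoeff_of_single, one_mul, HahnSeries.leadingCoeff_eq, hord,
      coeff_zero_ofPowerSeries, hg]

theorem le_order_expansion {f : SymmetricAlgebra K M} (hf : f ≠ 0) {k : ℕ}
    {F : (SymmetricAlgebra K M)[X]} (h : weightHom b w f = X ^ k * F) :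
    k ≤ (expansion L b w (algebraMap _ _ f)).order := by
  obtain ⟨l, F', hF', h'⟩ := exists_weightHom_eq (b := b) (w := w) hf
  rw [(order_expansion_of_eq L hF' h').1]
  by_contra! hlt
  apply hF'
  have : X ^ l * F' = X ^ l * (X * (X ^ (k - l - 1) * F)) := by
    rw [← h', h]
    have : k = l + (1 + (k - l - 1)) := by omega
    conv_lhs => rw [this]
    ring
  rw [mul_left_cancel₀ (pow_ne_zero _ X_ne_zero) this, mul_coeff_zero, coeff_X_zero, zero_mul]

end Expansion

section Action

variable {K V : Type*} [Field K] [AddCommGroup V] [Module K V] {G : Type*} [Group G]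
  {ι : Type*} {b : Module.Basis ι K (Module.Dual K V)} {w : ι → ℕ}

theorem order_expansion_le (ρ : Representation K G V) {g : G}
    (hg : ∀ a c, b.repr (ρ.dual g (b a)) c ≠ 0 → w a ≤ w c) (f : PolyRing K V) (hf : f ≠ 0) :
    (expansion (FunField K V) b w (algebraMap _ _ f)).order ≤
      (expansion (FunField K V) b w (fieldAction ρ g (algebraMap _ _ f))).order := by
  obtain ⟨k, F, hF, h⟩ := exists_weightHom_eq (b := b) (w := w) hf
  rw [(order_expansion_of_eq (FunField K V) hF h).1, fieldAction_algebraMap]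
  refine le_order_expansion (FunField K V) (by simpa using hf) (F := deform b w (ρ.dual g) F) ?_
  change weightHom b w (SymmetricAlgebra.lift (SymmetricAlgebra.ι K _ ∘ₗ ρ.dual g) f) = _
  rw [← deform_weightHom hg, h, map_mul, map_pow, deform_X]

/-- On polynomials neither `g` nor `g⁻¹` lowers the order, so both preserve it; quotients follow. -/
theorem order_expansion_fieldAction (ρ : Representation K G V) {g : G}
    (hg : ∀ a c, b.repr (ρ.dual g (b a)) c ≠ 0 → w a ≤ w c)
    (hg' : ∀ a c, b.repr (ρ.dual g⁻¹ (b a)) c ≠ 0 → w a ≤ w c) (x : FunField K V) :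
    (expansion (FunField K V) b w (fieldAction ρ g x)).order = (expansion (FunField K V) b w x).order := by
  have key : ∀ f : PolyRing K V, f ≠ 0 → (expansion (FunField K V) b w (fieldAction ρ g (algebraMap _ _ f))).order =
      (expansion (FunField K V) b w (algebraMap _ _ f)).order := by
    intro f hf
    refine le_antisymm ?_ (order_expansion_le ρ hg f hf)
    have := order_expansion_le (b := b) (w := w) ρ hg' (polyAction ρ g f) (by simpa using hf)
    rw [← fieldAction_algebraMap, map_inv] at this
    exact this.trans_eq (by rw [← AlgEquiv.mul_apply, inv_mul_cancel, AlgEquiv.one_apply])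
  rcases eq_or_ne x 0 with rfl | hx
  · simp
  obtain ⟨f, h, hh, rfl⟩ := IsFractionRing.div_surjective (A := PolyRing K V) x
  have hh0 : h ≠ 0 := nonZeroDivisors.ne_zero hh
  have hf0 : f ≠ 0 := by
    rintro rfl
    simp at hx
  have hf1 : algebraMap (PolyRing K V) (FunField K V) f ≠ 0 := by simpa using hf0
  have hh1 : algebraMap (PolyRing K V) (FunField K V) h ≠ 0 := by simpa using hh0
  rw [map_div₀, order_div _ (by simpa using hf0) (by simpa using hh0), order_div _ hf1 hh1,
    key f hf0, key h hh0]

theorem leadHom_expansion_fieldAction (ρ : Representation K G V) {g : G}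
    (hg : ∀ a c, b.repr (ρ.dual g (b a)) c ≠ 0 → w a ≤ w c)
    (hg' : ∀ a c, b.repr ((ρ.dual g - 1) (b a)) c ≠ 0 → w a < w c) (x : FunField K V) :
    leadHom (expansion (FunField K V) b w) (fieldAction ρ g x) = leadHom (expansion (FunField K V) b w) x := by
  have key : ∀ f : PolyRing K V, leadHom (expansion (FunField K V) b w) (fieldAction ρ g (algebraMap _ _ f)) =
      leadHom (expansion (FunField K V) b w) (algebraMap _ _ f) := by
    intro f
    rcases eq_or_ne f 0 with rfl | hf
    · simp
    obtain ⟨k, F, hF, h⟩ := exists_weightHom_eq (b := b) (w := w) hf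
    have h' : weightHom b w (polyAction ρ g f) = X ^ k * deform b w (ρ.dual g) F := by
      change weightHom b w (SymmetricAlgebra.lift (SymmetricAlgebra.ι K _ ∘ₗ ρ.dual g) f) = _
      rw [← deform_weightHom hg, h, map_mul, map_pow, deform_X]
    have hc := coeff_zero_deform hg' F
    rw [fieldAction_algebraMap, (order_expansion_of_eq (FunField K V) hF h).2,
      (order_expansion_of_eq (FunField K V) (by rwa [hc]) h').2, hc]
  obtain ⟨f, h, -, rfl⟩ := IsFractionRing.div_surjective (A := PolyRing K V) x
  simp only [map_div₀, key]

end Action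

end

/-! ### Torus and unipotents of `SL₂`, and the embedding of `F` -/

section

open Polynomial in
-- The image of a generator of `Fˣ` is a primitive root of unity of order `|F| - 1`, so `X ^ |F| -
-- X`, whose splitting field is `F`, splits in `K`.
theorem nonempty_ringHom_of_injective_units {F K : Type*} [Field F] [Finite F] [Field K] (p : ℕ)
    [Fact p.Prime] [CharP F p] [CharP K p] (χ : Fˣ →* K) (hχ : Function.Injective χ) :
    Nonempty (F →+* K) := by
  have := Fintype.ofFinite F
  let _ : Algebra (ZMod p) F := ZMod.algebra F p
  let _ : Algebra (ZMod p) K := ZMod.algebra K p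
  obtain ⟨a, ha⟩ := IsCyclic.exists_ofOrder_eq_natCard (α := Fˣ)
  have hprim : IsPrimitiveRoot (χ a) (Fintype.card F - 1) := by
    have h1 := (IsPrimitiveRoot.orderOf a).map_of_injective hχ
    rwa [ha, Nat.card_units, Nat.card_eq_fintype_card] at h1
  refine ⟨(IsSplittingField.lift F (X ^ Fintype.card F - X : (ZMod p)[X]) ?_ : F →ₐ[ZMod p] K)⟩
  have hcard : Fintype.card F = (Fintype.card F - 1) + 1 := by
    have := Fintype.card_pos (α := F)
    omega
  rw [hcard, pow_succ', ← mul_sub_one, Polynomial.map_mul, map_X]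
  refine Splits.mul Splits.X ?_
  simpa using X_pow_sub_one_splits hprim

section Restrict

variable {K L G : Type*} [Field K] [Field L] [Algebra K L] [Group G]

/-- The action of `G` on a stable subfield. -/
def restrictAction (φ : G →* (L ≃ₐ[K] L)) (E : IntermediateField K L)
    (hE : ∀ g, ∀ x ∈ E, φ g x ∈ E) : G →* (E →ₐ[K] E) where
  toFun g := ((φ g : L →ₐ[K] L).comp E.val).codRestrict E.toSubalgebra fun x => hE g x x.2
  map_one' := by
    ext x
    change φ 1 x = x
    simp
  map_mul' g h := by
    ext x
    change φ (g * h) x = φ g (φ h x)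
    simp

end Restrict

section SL2

open Matrix

variable {F : Type*} [Field F]

/-- The upper unipotent elements of `SL₂`. -/
def unipotent (a : F) : SpecialLinearGroup (Fin 2) F := ⟨!![1, a; 0, 1], by simp⟩

theorem coe_unipotent (a : F) : (unipotent a : Matrix (Fin 2) (Fin 2) F) = !![1, a; 0, 1] := rfl

theorem coe_injective :
    Function.Injective (fun A : SpecialLinearGroup (Fin 2) F => (A : Matrix (Fin 2) (Fin 2) F)) :=
  Subtype.val_injective

theorem unipotent_mul (a b : F) : unipotent a * unipotent b = unipotent (a + b) := by
  apply coe_injective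
  simp [coe_unipotent, add_comm]

theorem unipotent_eq_one_iff {a : F} : unipotent a = 1 ↔ a = 0 := by
  rw [← coe_injective.eq_iff]
  simp [coe_unipotent, Matrix.one_fin_two]

/-- The diagonal elements of `SL₂`. -/
def diag (a : Fˣ) : SpecialLinearGroup (Fin 2) F := ⟨!![(a : F), 0; 0, ((a⁻¹ : Fˣ) : F)], by simp⟩

theorem coe_diag (a : Fˣ) :
    (diag a : Matrix (Fin 2) (Fin 2) F) = !![(a : F), 0; 0, ((a⁻¹ : Fˣ) : F)] := rfl

/-- The diagonal torus of `SL₂`. -/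
def torus : Fˣ →* SpecialLinearGroup (Fin 2) F where
  toFun := diag
  map_one' := by
    apply coe_injective
    simp [coe_diag, Matrix.one_fin_two]
  map_mul' a b := by
    apply coe_injective
    simp [coe_diag, mul_comm]

theorem torus_apply (a : Fˣ) : torus a = diag a := rfl

theorem torus_injective : Function.Injective (torus (F := F)) := by
  intro a b h
  rw [← coe_injective.eq_iff] at h
  exact Units.ext (by simpa [torus_apply, coe_diag] using congrFun (congrFun h 0) 0)

theorem unipotent_mul_torus (b : F) (a : Fˣ) :
    unipotent b * torus a = torus a * unipotent ((a⁻¹ : Fˣ) * b * (a⁻¹ : Fˣ)) := by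
  apply coe_injective
  simp [torus_apply, coe_diag, coe_unipotent, ← mul_assoc]

end SL2

section Borel

open Matrix

variable {K V F : Type*} [Field K] [CharP K 2] [AddCommGroup V] [Module K V] [Field F] [Finite F]

/-- Weights adapted to a representation `D` of the additive group of `F` in characteristic two. -/
theorem exists_weighted_basis_of_unipotent {M : Type*} [AddCommGroup M] [Module K M] [CharP F 2]
    (D : F → Module.End K M) (h0 : D 0 = 1) (hadd : ∀ a b, D (a + b) = D a * D b) :
    ∃ (s : Set M) (b : Module.Basis s K M) (w : s → ℕ),
      (∀ g : Module.End K M, (∀ i, ∃ i', D i * g = g * D i') →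
        ∀ a c, b.repr (g (b a)) c ≠ 0 → w a ≤ w c) ∧
      ∀ i a c, b.repr ((D i - 1) (b a)) c ≠ 0 → w a < w c := by
  have hcomm' : ∀ a b, Commute (D a) (D b) := fun a b => by
    rw [Commute, SemiconjBy, ← hadd, ← hadd, add_comm]
  have hcomm : ∀ a b, Commute (D a - 1) (D b - 1) := fun a b =>
    ((hcomm' a b).sub_left (Commute.one_left _)).sub_right (Commute.one_right _)
  have hsq : ∀ a, (D a - 1) * (D a - 1) = 0 := fun a => by
    have h1 : D a * D a = 1 := by
      rw [← hadd, CharTwo.add_self_eq_zero, h0]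
    have h2 : ∀ x : Module.End K M, x + x = 0 := fun x => by
      rw [← two_smul K x, CharTwo.two_eq_zero, zero_smul]
    have : (D a - 1) * (D a - 1) = (1 + 1) - (D a + D a) := by
      simp only [sub_mul, mul_sub, h1, one_mul, mul_one]
      abel
    rw [this, h2, h2, sub_self]
  obtain ⟨s, b, w, hw, hfw⟩ := exists_weighted_basis (f := fun a => D a - 1) hcomm hsq
  refine ⟨s, b, w, fun g hg => hw g fun i => ?_, hfw⟩
  obtain ⟨i', hi'⟩ := hg i
  exact ⟨i', by rw [sub_mul, mul_sub, one_mul, mul_one, hi']⟩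

/-- The Borel subgroup of `SL₂(F)` fixes a discrete valuation of `K(V)` with the unipotent radical
acting trivially on leading coefficients. -/
theorem exists_borel_expansion [CharP F 2] (ρ : Representation K (SpecialLinearGroup (Fin 2) F) V) :
    ∃ Φ : FunField K V →+* LaurentSeries (FunField K V),
      (∀ c, Φ (algebraMap K _ c) = HahnSeries.C (algebraMap K _ c)) ∧
      (∀ a x, (Φ (fieldAction ρ (torus a) x)).order = (Φ x).order) ∧
      (∀ a x, (Φ (fieldAction ρ (unipotent a) x)).order = (Φ x).order) ∧
      ∀ a x, leadHom (L := FunField K V) (M := FunField K V) Φ (fieldAction ρ (unipotent a) x) = leadHom Φ x := by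
  obtain ⟨s, b, w, hw, hfw⟩ := exists_weighted_basis_of_unipotent
    (fun a : F => ρ.dual (unipotent a)) (by rw [unipotent_eq_one_iff.mpr rfl, map_one])
    (fun a c => by rw [← unipotent_mul, map_mul])
  have hu : ∀ a : F, ∀ i j, b.repr (ρ.dual (unipotent a) (b i)) j ≠ 0 → w i ≤ w j := fun a =>
    hw _ fun i => ⟨i, by rw [← map_mul, ← map_mul, unipotent_mul, unipotent_mul, add_comm]⟩
  -- The torus normalizes the unipotents, so it preserves the filtration and does not lower weights.
  have ht : ∀ a : Fˣ, ∀ i j, b.repr (ρ.dual (torus a) (b i)) j ≠ 0 → w i ≤ w j := fun a =>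
    hw _ fun i => ⟨(a⁻¹ : Fˣ) * i * (a⁻¹ : Fˣ), by
      rw [← map_mul, ← map_mul, unipotent_mul_torus]⟩
  have hinv : ∀ a : F, (unipotent a)⁻¹ = unipotent (-a) := fun a => by
    rw [inv_eq_iff_mul_eq_one, unipotent_mul, unipotent_eq_one_iff, add_neg_cancel]
  refine ⟨expansion (FunField K V) b w, expansion_algebraMap_base _ b w, fun a x => ?_,
    fun a x => ?_, fun a x => ?_⟩
  · exact order_expansion_fieldAction ρ (ht a) (by rw [← map_inv]; exact ht a⁻¹) x
  · exact order_expansion_fieldAction ρ (hu a) (by rw [hinv]; exact hu _) x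
  · exact leadHom_expansion_fieldAction ρ (hu a) (hfw a) x

theorem nonempty_ringHom_of_faithful_subfield {K F L M : Type*} [Field K] [CharP K 2] [Field F]
    [Finite F] [CharP F 2] [Field L] [Algebra K L] [Field M] [Algebra K M]
    (hM : ∀ x : M, IsAlgebraic K x → ∃ c, algebraMap K M c = x)
    (φ : SpecialLinearGroup (Fin 2) F →* (L ≃ₐ[K] L)) (Φ : L →+* LaurentSeries M)
    (hΦ : ∀ c, Φ (algebraMap K L c) = HahnSeries.C (algebraMap K M c))
    (ht : ∀ a x, (Φ (φ (torus a) x)).order = (Φ x).order)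
    (hu : ∀ a x, (Φ (φ (unipotent a) x)).order = (Φ x).order)
    (hlead : ∀ a x, leadHom Φ (φ (unipotent a) x) = leadHom Φ x)
    {E : IntermediateField K L} (hE : IsFaithfulGSubfield φ E)
    (htr : Algebra.trdeg K E = 1) : Nonempty (F →+* K) := by
  by_cases hp : ∃ p : E, (Φ p).order ≠ 0
  · obtain ⟨p, hp⟩ := hp
    obtain ⟨χ, hχ⟩ := exists_character (H := Fˣ) hM (Φ.comp (algebraMap E L)) (fun c => hΦ c) htr (p := p) hp
      ((restrictAction φ E hE.stable).comp torus) (fun a x => ht a x)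
    refine nonempty_ringHom_of_injective_units 2 χ ?_
    -- `|F|` vanishes in `K`, so `|Fˣ|` becomes `-1`.
    have hcard : (Nat.card Fˣ : K) ≠ 0 := by
      have := Fintype.ofFinite F
      have h0 : (Nat.card F : K) = 0 := by
        rw [CharP.cast_eq_zero_iff K 2, ← CharP.cast_eq_zero_iff F 2, Nat.card_eq_fintype_card]
        exact Nat.cast_card_eq_zero F
      have h1 : Nat.card F = Nat.card Fˣ + 1 := by
        rw [Nat.card_units]
        have := Nat.card_pos (α := F)
        omega
      rw [h1] at h0
      push_cast at h0
      intro h2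
      simp [h2] at h0
    have hker : ∀ a, χ a = 1 → a = 1 := by
      intro a ha
      have h1 := hχ a (Nat.card Fˣ) hcard (pow_card_eq_one') ha
      apply torus_injective
      rw [map_one]
      refine hE.faithful _ fun x hx => ?_
      exact congrArg Subtype.val (DFunLike.congr_fun h1 ⟨x, hx⟩)
    intro a c hac
    have h1 : χ (a * c⁻¹) = 1 := by
      rw [map_mul, hac, ← map_mul, mul_inv_cancel, map_one]
    exact mul_inv_eq_one.mp (hker _ h1)
  -- The valuation is trivial on `E`: `u x - x` lies in `E`, so has order 0, yet its constant
  -- coefficient cancels. Hence it is zero and `u` fixes `E`.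
  · push Not at hp
    exfalso
    refine one_ne_zero (α := F) (unipotent_eq_one_iff.mp (hE.faithful _ fun x hx => ?_))
    by_contra hne
    have hxE := hE.stable (unipotent (1 : F)) x hx
    have hy := hp ⟨_, sub_mem hxE hx⟩
    have hy0 : φ (unipotent 1) x - x ≠ 0 := sub_ne_zero.mpr hne
    have h1 := hlead 1 x
    rw [leadHom_apply, leadHom_apply, hu, hp ⟨x, hx⟩] at h1
    have h2 : (Φ (φ (unipotent 1) x - x)).coeff 0 = 0 := by
      rw [map_sub, HahnSeries.coeff_sub, h1, sub_self]
    rw [← hy, HahnSeries.coeff_order_eq_zero] at h2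
    exact hy0 ((map_eq_zero Φ).mp h2)

end Borel

theorem trdeg_ne_zero_of_faithful {K L G : Type*} [Field K] [Field L] [Algebra K L] [Group G]
    [Nontrivial G] (hL : ∀ x : L, IsAlgebraic K x → ∃ c, algebraMap K L c = x)
    {φ : G →* (L ≃ₐ[K] L)} {E : IntermediateField K L} (hE : IsFaithfulGSubfield φ E) :
    Algebra.trdeg K E ≠ 0 := by
  intro h
  have halg := trdeg_eq_zero_iff.mp h
  obtain ⟨g, hg⟩ := exists_ne (1 : G)
  refine hg (hE.faithful g fun x hx => ?_)
  obtain ⟨c, rfl⟩ := hL x ((halg.isAlgebraic ⟨x, hx⟩).algebraMap (A := L))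
  exact AlgEquiv.commutes _ _

end

end EssDim

end

theorem theorem1p6 {K : Type*} [Field K] [CharP K 2]
    (q : ℕ) (hq : ∃ r : ℕ, 0 < r ∧ q = 2 ^ r)
    {F : Type*} [Field F] (hF : Nat.card F = q)
    {V : Type*} [AddCommGroup V] [Module K V] [FiniteDimensional K V]
    (ρ : Representation K (Matrix.SpecialLinearGroup (Fin 2) F) V)
    (hρ : Function.Injective ρ) :
    EssDim.essDim ρ = 1 ↔ Nonempty (F →+* K) := by
  obtain ⟨r, hr, rfl⟩ := hq
  have : Finite F := Nat.finite_of_card_ne_zero (by rw [hF]; positivity)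
  have : CharP F 2 := by
    have := Fintype.ofFinite F
    have h0 : ((2 ^ r : ℕ) : F) = 0 := by
      rw [← hF, Nat.card_eq_fintype_card]
      exact Nat.cast_card_eq_zero F
    rw [Nat.cast_pow, Nat.cast_ofNat] at h0
    exact CharTwo.of_one_ne_zero_of_two_eq_zero one_ne_zero (pow_eq_zero_iff hr.ne' |>.mp h0)
  have : Nontrivial (Matrix.SpecialLinearGroup (Fin 2) F) :=
    ⟨EssDim.unipotent 1, 1, fun h => one_ne_zero (EssDim.unipotent_eq_one_iff.mp h)⟩
  have hL : ∀ x : EssDim.FunField K V, IsAlgebraic K x → ∃ c, algebraMap K _ c = x :=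
    fun _ => EssDim.exists_algebraMap_eq_of_isAlgebraic
  rw [EssDim.essDim]
  constructor
  · intro h
    -- The infimum of the empty set is 0, so the value 1 is attained by a genuine subfield.
    have hne := Nat.nonempty_of_sInf_eq_succ h
    obtain ⟨E, hE, htr⟩ := Nat.sInf_mem hne
    rw [h, Nat.cast_one] at htr
    obtain ⟨Φ, hΦ, ht, hu, hlead⟩ := EssDim.exists_borel_expansion ρ
    exact EssDim.nonempty_ringHom_of_faithful_subfield (L := EssDim.FunField K V)
      (M := EssDim.FunField K V) hL (EssDim.fieldAction ρ) Φ hΦ ht hu hlead hE htr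
  · rintro ⟨j⟩
    obtain ⟨E, hE, htr⟩ := EssDim.exists_faithful_subfield_trdeg_one (L := EssDim.FunField K V)
      hL (EssDim.fieldAction ρ) (EssDim.fieldAction_injective ρ hρ) j
    refine le_antisymm (Nat.sInf_le ⟨E, hE, by rw [htr, Nat.cast_one]⟩) ?_
    refine le_csInf ⟨1, E, hE, by rw [htr, Nat.cast_one]⟩ ?_
    rintro n ⟨E', hE', htr'⟩
    rw [Nat.one_le_iff_ne_zero]
    rintro rfl
    exact EssDim.trdeg_ne_zero_of_faithful (L := EssDim.FunField K V) hL hE'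
      (by rw [htr', Nat.cast_zero])
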